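/- Consider the Lorenz system $$x' = 10(y-x),\qquad y' = 28x - y - xz,\qquad z' = -\tfrac83 z + xy$$ for functions of a complex time $t$. For complex constants $C,D$ let $P_m$ $(m\ge -1)$, $Q_m$, $R_m$ $(m\ge -2)$ be the following polynomials in $s=\eta+C$. First, $$P_{-1}=2i,\quad Q_{-2}=-\tfrac{i}{5},\quad R_{-2}=-\tfrac15,\qquad P_0=\tfrac{71}{9}i,\quad Q_{-1}=2i,\quad R_{-1}=\tfrac{17}{9},$$ $$P_1=-\tfrac{9880}{81}is,\quad Q_0=-\tfrac{349}{81}i-\tfrac{988}{81}is,\quad R_0=\tfrac{1385}{54}-\tfrac{988}{81}s,$$ $$P_2=-\tfrac{2108195}{972}i+\tfrac{469300}{243}is,\quad Q_1=-\tfrac{25991}{108}i+\tfrac{64220}{243}is,\quad R_1=-\tfrac{211189}{972}+\tfrac{167960}{729}s,$$ $$P_3=iD-\tfrac{96356411}{6561}is-\tfrac{2736760}{6561}is^2,$$ $$Q_2=\tfrac{3}{10}iD-\tfrac{477319147}{131220}i-\tfrac{167831753}{65610}is-\tfrac{273676}{2187}is^2,$$ $$R_2=-\tfrac15D+\tfrac{138959125}{17496}-\tfrac{58846039}{32805}s-\tfrac{1444456}{2187}s^2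 .$$ For $m\ge 3$, the vector $X_m=(P_{m+1},Q_m,R_m)^T$ is defined recursively by $$X_m=-\sum_{j=0}^{\lfloor (m+2)/2\rfloor}A_m^{-j-1}\,\frac{d^jF_m}{ds^j},\qquad A_m=\begin{pmatrix}-m-1&10&0\\ \frac15&-m&-2i\\ -\frac i5&2i&-m\end{pmatrix},$$ $$F_m=\begin{pmatrix}-10P_m\\ 28P_{m-1}-Q_{m-1}-\sum_{j=0}^mP_jR_{m-j-1}\\ -\frac83R_{m-1}+\sum_{j=0}^mP_jQ_{m-j-1}\end{pmatrix}.$$ For $t_0,b\in\mathbb C$ with $|b|=1$ and $\varepsilon\in\{1,-1\}$ put $\eta=\log(b(t-t_0))$ (principal branch), let $\Gamma=\{t_0-\bar b\,p: p\ge 0\}$ be the branch cut (which contains $t_0$), and consider the psi series $$x(t)=\varepsilon\sum_{m=-1}^\infty P_m(t-t_0)^m,\quad y(t)=\varepsilon\sum_{m=-2}^\infty Q_m(t-t_0)^m,\quad z(t)=\sum_{m=-2}^\infty R_m(t-t_0)^m,$$ where $P_m,Q_m,R_m$ are evaluated at $s=\eta+C$. **Theorem.** (i) For all $C,D\in\mathbb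 C$ there is $r>0$, depending only on $C$ and $D$, such that for all $t_0\in\mathbb C$, all $b$ with $|b|=1$ and both signs $\varepsilon$, the three series converge absolutely at every $t$ with $|t-t_0|\le r$ and $t\notin\Gamma$, and their sums are complex differentiable and satisfy the Lorenz system at every such $t$. Moreover these solutions are singular at $t_0$: $|x(t)|,|y(t)|,|z(t)|\to\infty$ as $t\to t_0$, $t\notin\Gamma$. (ii) The solutions form a genuine two-parameter family: for fixed $t_0,b,\varepsilon$, if $(C,D)\ne(C',D')$, then every disc $|t-t_0|<\rho$, $\rho>0$, contains a point $t\notin\Gamma$ at which the triples $(x,y,z)$ for $(C,D)$ and for $(C',D')$ differ. -/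

import Mathlib

noncomputable section

namespace LorenzPsi

open Polynomial

/-- `(x, y, z)` satisfies the Lorenz system at the complex time `t`. -/
def SatisfiesLorenzAt (x y z : ℂ → ℂ) (t : ℂ) : Prop :=
  HasDerivAt x (10 * (y t - x t)) t ∧
  HasDerivAt y (28 * x t - y t - x t * z t) t ∧
  HasDerivAt z (-8 * z t / 3 + x t * y t) t

/-- The polynomial `a₀ + a₁ s + a₂ s²`; the indeterminate `s` stands for `η + C`. -/
def quad (a₀ a₁ a₂ : ℂ) : ℂ[X] :=
  Polynomial.C a₀ + Polynomial.C a₁ * X + Polynomial.C a₂ * X ^ 2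

/-- The matrix `A_m` of the recursion. -/
def recMatrix (m : ℕ) : Matrix (Fin 3) (Fin 3) ℂ :=
  !![-(m : ℂ) - 1, 10, 0;
     1 / 5, -(m : ℂ), -2 * Complex.I;
     -Complex.I / 5, 2 * Complex.I, -(m : ℂ)]

/-- The polynomial solution `-∑_{j ≤ (m+2)/2} A_m^{-(j+1)} F^{(j)}` of `X' = A_m X + F`
(derivatives with respect to the polynomial variable). -/
def recSolve (m : ℕ) (F : Fin 3 → ℂ[X]) : Fin 3 → ℂ[X] :=
  -∑ j ∈ Finset.range ((m + 2) / 2 + 1),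
    (((recMatrix m)⁻¹ ^ (j + 1)).map Polynomial.C).mulVec fun i => derivative^[j] (F i)

/-- The coefficient triples `coeff D n = (P_{n-1}, Q_{n-2}, R_{n-2})`, that is `X_m` with
`m = n - 2`, as polynomials in `s = η + C`. For `m ≤ 2` they are listed explicitly, and for
`m ≥ 3` (`m = k + 3`, `n = k + 5`) they are given by `recSolve m F_m`, where
`F_m = (-10 P_m, 28 P_{m-1} - Q_{m-1} - ∑_{j=0}^m P_j R_{m-j-1},
  -(8/3) R_{m-1} + ∑_{j=0}^m P_j Q_{m-j-1})`. -/
def coeff (D : ℂ) : ℕ → Fin 3 → ℂ[X]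
  | 0 => ![quad (2 * Complex.I) 0 0, quad (-Complex.I / 5) 0 0, quad (-1 / 5) 0 0]
  | 1 => ![quad (71 / 9 * Complex.I) 0 0, quad (2 * Complex.I) 0 0, quad (17 / 9) 0 0]
  | 2 => ![quad 0 (-9880 / 81 * Complex.I) 0,
           quad (-349 / 81 * Complex.I) (-988 / 81 * Complex.I) 0,
           quad (1385 / 54) (-988 / 81) 0]
  | 3 => ![quad (-2108195 / 972 * Complex.I) (469300 / 243 * Complex.I) 0,
           quad (-25991 / 108 * Complex.I) (64220 / 243 * Complex.I) 0,
           quad (-211189 / 972) (167960 / 729) 0]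
  | 4 => ![quad (Complex.I * D) (-96356411 / 6561 * Complex.I) (-2736760 / 6561 * Complex.I),
           quad (3 / 10 * Complex.I * D - 477319147 / 131220 * Complex.I)
             (-167831753 / 65610 * Complex.I) (-273676 / 2187 * Complex.I),
           quad (-1 / 5 * D + 138959125 / 17496) (-58846039 / 32805) (-1444456 / 2187)]
  | k + 5 => recSolve (k + 3)
      ![-(10 * coeff D (k + 4) 0),
        28 * coeff D (k + 3) 0 - coeff D (k + 4) 1
          - ∑ j : Fin (k + 4), coeff D ((j : ℕ) + 1) 0 * coeff D (k + 4 - (j : ℕ)) 2,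
        -(Polynomial.C (8 / 3) * coeff D (k + 4) 2)
          + ∑ j : Fin (k + 4), coeff D ((j : ℕ) + 1) 0 * coeff D (k + 4 - (j : ℕ)) 1]
termination_by n => n
decreasing_by all_goals omega

/-- `η + C` with `η = log (b (t - t₀))`, principal branch. -/
def etaC (b t₀ C t : ℂ) : ℂ := Complex.log (b * (t - t₀)) + C

/-- The ray `{t₀ - b̄ p | p ≥ 0}` from the singular point `t₀` (included), on which
`log (b (t - t₀))` has its cut. -/
def branchCut (b t₀ : ℂ) : Set ℂ :=
  {t | ∃ p : ℝ, 0 ≤ p ∧ t = t₀ - (starRingEnd ℂ) b * (p : ℂ)}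

/-- The terms of the psi series for `x`: `ε P_{n-1}(η) (t - t₀)^{n-1}`, for `n = 0, 1, 2, …`.
The sign `ε = ±1` selects one of the two families of coefficients. -/
def xTerm (ε b t₀ C D t : ℂ) (n : ℕ) : ℂ :=
  ε * (coeff D n 0).eval (etaC b t₀ C t) * (t - t₀) ^ ((n : ℤ) - 1)

/-- The terms `ε Q_{n-2}(η) (t - t₀)^{n-2}` of the psi series for `y`. -/
def yTerm (ε b t₀ C D t : ℂ) (n : ℕ) : ℂ :=
  ε * (coeff D n 1).eval (etaC b t₀ C t) * (t - t₀) ^ ((n : ℤ) - 2)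

/-- The terms `R_{n-2}(η) (t - t₀)^{n-2}` of the psi series for `z`. -/
def zTerm (b t₀ C D t : ℂ) (n : ℕ) : ℂ :=
  (coeff D n 2).eval (etaC b t₀ C t) * (t - t₀) ^ ((n : ℤ) - 2)

def psiX (ε b t₀ C D t : ℂ) : ℂ := ∑' n, xTerm ε b t₀ C D t n

def psiY (ε b t₀ C D t : ℂ) : ℂ := ∑' n, yTerm ε b t₀ C D t n

def psiZ (b t₀ C D t : ℂ) : ℂ := ∑' n, zTerm b t₀ C D t n

end LorenzPsi

end

noncomputable section

namespace LorenzPsi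

open Polynomial

/-! Since `η' = 1 / (t - t₀)`, inserting the psi series into the Lorenz system and comparing powers
of `t - t₀` gives the linear systems `X' = A_m X + F_m` for polynomials in `s`. The determinant `-m
(m - 2) (m + 3)` of `A_m` vanishes at the resonances `m = 0, 2`, where the freedom `C`, `D` enters.
For `m ≥ 3` the Neumann sum for `(d/ds - A_m)⁻¹` ends after finitely many terms
(`derivative_recSolve`).

Convergence rests on a majorant in the weighted norm `absEval 480`. As `A_m⁻¹` is `O(1/m)` and the
degrees are at most `(m + 2) / 2`, each factor `A_m⁻¹ d/ds` is bounded independently of `m`, and the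
weight makes that bound `1/2`. Solving thus gains `1/m`, which pays for the number of products in
`F_m`, and the coefficients grow geometrically (`exists_absEval_coeff_le`). With `‖η + C‖ = O(1 +
|log ‖t - t₀‖|)`, the series is dominated by a geometric one whose ratio `gauge` tends to `0`
(`exists_dominates`).

This bound justifies termwise differentiation and Cauchy products, shows that the leading term wins
at `t₀`, and makes a truncated series asymptotic. Hence the first coefficient in which two series
for `x` differ can be recovered from the sums (`eq_zero_of_psiSum_eq`): `P₁` determines `C`, then
`P₃` determines `D`. -/

/-! ### A submultiplicative weighted norm on polynomials -/

/-- The weighted `ℓ¹` norm `∑ ‖a_k‖ ρ ^ k` of the polynomial `∑ a_k X ^ k`. -/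
def absEval (ρ : ℝ) (p : ℂ[X]) : ℝ := p.sum fun k a => ‖a‖ * ρ ^ k

lemma absEval_eq_sum_range (ρ : ℝ) {p : ℂ[X]} {n : ℕ} (h : p.natDegree < n) :
    absEval ρ p = ∑ k ∈ Finset.range n, ‖p.coeff k‖ * ρ ^ k :=
  Polynomial.sum_over_range' p (by simp) n h

lemma absEval_nonneg {ρ : ℝ} (hρ : 0 ≤ ρ) (p : ℂ[X]) : 0 ≤ absEval ρ p :=
  Finset.sum_nonneg fun k _ => by positivity

@[simp] lemma absEval_zero (ρ : ℝ) : absEval ρ 0 = 0 := by simp [absEval]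

@[simp] lemma absEval_neg (ρ : ℝ) (p : ℂ[X]) : absEval ρ (-p) = absEval ρ p := by
  rw [absEval_eq_sum_range ρ (n := p.natDegree + 1) (by simp),
    absEval_eq_sum_range ρ (n := p.natDegree + 1) (by simp)]
  simp

lemma absEval_add_le {ρ : ℝ} (hρ : 0 ≤ ρ) (p q : ℂ[X]) :
    absEval ρ (p + q) ≤ absEval ρ p + absEval ρ q := by
  have hn : (p + q).natDegree < max p.natDegree q.natDegree + 1 :=
    Nat.lt_succ_of_le (natDegree_add_le p q)
  rw [absEval_eq_sum_range ρ hn,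
    absEval_eq_sum_range ρ (p := p) (Nat.lt_succ_of_le (le_max_left _ _)),
    absEval_eq_sum_range ρ (p := q) (Nat.lt_succ_of_le (le_max_right _ _)),
    ← Finset.sum_add_distrib]
  refine Finset.sum_le_sum fun k _ => ?_
  rw [coeff_add, ← add_mul]
  gcongr
  exact norm_add_le _ _

lemma absEval_sub_le {ρ : ℝ} (hρ : 0 ≤ ρ) (p q : ℂ[X]) :
    absEval ρ (p - q) ≤ absEval ρ p + absEval ρ q := by
  simpa [sub_eq_add_neg] using absEval_add_le hρ p (-q)

lemma absEval_sum_le {ρ : ℝ} (hρ : 0 ≤ ρ) {ι : Type*} (s : Finset ι) (f : ι → ℂ[X]) :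
    absEval ρ (∑ i ∈ s, f i) ≤ ∑ i ∈ s, absEval ρ (f i) :=
  Finset.le_sum_of_subadditive (absEval ρ) (absEval_zero ρ).le (absEval_add_le hρ) s f

lemma absEval_monomial_mul (ρ : ℝ) (k : ℕ) (a : ℂ) (q : ℂ[X]) :
    absEval ρ (monomial k a * q) = ‖a‖ * ρ ^ k * absEval ρ q := by
  have hn : (monomial k a * q).natDegree < k + (q.natDegree + 1) := by
    have h₁ := natDegree_mul_le (p := monomial k a) (q := q)
    have h₂ := natDegree_monomial_le a (m := k)
    omega
  rw [absEval_eq_sum_range ρ hn, absEval_eq_sum_range ρ (Nat.lt_succ_self q.natDegree),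
    Finset.sum_range_add, Finset.mul_sum, Finset.sum_eq_zero, zero_add]
  · refine Finset.sum_congr rfl fun j _ => ?_
    rw [← C_mul_X_pow_eq_monomial, mul_assoc, coeff_C_mul, add_comm k j, coeff_X_pow_mul,
      norm_mul, pow_add]
    ring
  · intro j hj
    rw [← C_mul_X_pow_eq_monomial, mul_assoc, coeff_C_mul, coeff_X_pow_mul',
      if_neg (by simpa using hj)]
    simp

lemma absEval_C_mul (ρ : ℝ) (a : ℂ) (q : ℂ[X]) :
    absEval ρ (Polynomial.C a * q) = ‖a‖ * absEval ρ q := by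
  simpa using absEval_monomial_mul ρ 0 a q

lemma absEval_mul_le {ρ : ℝ} (hρ : 0 ≤ ρ) (p q : ℂ[X]) :
    absEval ρ (p * q) ≤ absEval ρ p * absEval ρ q := by
  conv_lhs => rw [p.as_sum_support, Finset.sum_mul]
  refine (absEval_sum_le hρ _ _).trans (le_of_eq ?_)
  simp_rw [absEval_monomial_mul]
  rw [← Finset.sum_mul]
  rfl

/-- Differentiation brings down a factor `k ≤ d` and loses one power of `ρ`, so a large weight makes
it cheap. -/
lemma absEval_derivative_le {ρ : ℝ} (hρ : 0 < ρ) {p : ℂ[X]} {d : ℕ} (hd : p.natDegree ≤ d) :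
    absEval ρ (derivative p) ≤ d / ρ * absEval ρ p := by
  have h' : (derivative p).natDegree < d + 1 :=
    lt_of_le_of_lt ((natDegree_derivative_le p).trans (Nat.sub_le _ _)) (by omega)
  rw [absEval_eq_sum_range ρ h',
    absEval_eq_sum_range ρ (n := d + 1 + 1) (p := p) (by omega), Finset.sum_range_succ' _ (d + 1),
    mul_add, Finset.mul_sum]
  have h0 : 0 ≤ d / ρ * (‖p.coeff 0‖ * ρ ^ 0) := by positivity
  refine le_trans (Finset.sum_le_sum fun k _ => ?_) (le_add_of_nonneg_right h0)
  rw [coeff_derivative, norm_mul]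
  rcases Nat.lt_or_ge d (k + 1) with hk | hk
  · rw [coeff_eq_zero_of_natDegree_lt (by omega)]
    simp
  · have h1 : ‖(k : ℂ) + 1‖ = k + 1 := by
      rw [← Nat.cast_succ, Complex.norm_natCast]
      simp
    have h2 : (k : ℝ) + 1 ≤ d := by exact_mod_cast hk
    rw [h1, pow_succ]
    calc ‖p.coeff (k + 1)‖ * (k + 1) * ρ ^ k ≤ ‖p.coeff (k + 1)‖ * d * ρ ^ k := by gcongr
      _ = d / ρ * (‖p.coeff (k + 1)‖ * (ρ ^ k * ρ)) := by field_simp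

lemma natDegree_iterate_derivative_le {p : ℂ[X]} {d : ℕ} (hd : p.natDegree ≤ d) (j : ℕ) :
    (derivative^[j] p).natDegree ≤ d :=
  (natDegree_iterate_derivative p j).trans ((Nat.sub_le _ _).trans hd)

lemma absEval_iterate_derivative_le {ρ : ℝ} (hρ : 0 < ρ) {p : ℂ[X]} {d : ℕ}
    (hd : p.natDegree ≤ d) (j : ℕ) :
    absEval ρ (derivative^[j] p) ≤ (d / ρ) ^ j * absEval ρ p := by
  induction j with
  | zero => simp
  | succ j ih =>
    rw [Function.iterate_succ_apply', pow_succ', mul_assoc]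
    exact (absEval_derivative_le hρ (natDegree_iterate_derivative_le hd j)).trans (by gcongr)

/-- Separates the size of the coefficients from the size `l` of the logarithm, which later depends
on `t`. -/
lemma norm_eval_le_absEval {ρ : ℝ} (hρ : 0 ≤ ρ) {p : ℂ[X]} {d : ℕ} (hd : p.natDegree ≤ d)
    {s : ℂ} {l : ℝ} (hl : 1 ≤ l) (hs : ‖s‖ ≤ ρ * l) :
    ‖p.eval s‖ ≤ absEval ρ p * l ^ d := by
  rw [eval_eq_sum_range' (Nat.lt_succ_of_le hd), absEval_eq_sum_range ρ (Nat.lt_succ_of_le hd),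
    Finset.sum_mul]
  refine (norm_sum_le _ _).trans (Finset.sum_le_sum fun k hk => ?_)
  rw [norm_mul, norm_pow, mul_assoc]
  have hk' : k ≤ d := Nat.lt_succ_iff.mp (Finset.mem_range.mp hk)
  gcongr
  calc ‖s‖ ^ k ≤ (ρ * l) ^ k := by gcongr
    _ = ρ ^ k * l ^ k := mul_pow _ _ _
    _ ≤ ρ ^ k * l ^ d := by gcongr

/-! ### The inverse of the recursion matrix -/

lemma det_recMatrix (m : ℕ) :
    (recMatrix m).det = -((m : ℂ) * ((m : ℂ) - 2) * ((m : ℂ) + 3)) := by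
  rw [recMatrix, Matrix.det_fin_three]
  simp
  ring_nf
  simp
  ring

lemma norm_det_recMatrix_ge {m : ℕ} (hm : 3 ≤ m) : (m : ℝ) ^ 3 / 3 ≤ ‖(recMatrix m).det‖ := by
  have hm' : (3 : ℝ) ≤ m := by exact_mod_cast hm
  have h : (recMatrix m).det = ((-((m : ℝ) * (m - 2) * (m + 3)) : ℝ) : ℂ) := by
    rw [det_recMatrix]; push_cast; ring
  rw [h, Complex.norm_real, Real.norm_eq_abs, abs_neg, abs_of_nonneg (by
    have : (0 : ℝ) ≤ m - 2 := by linarith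
    positivity)]
  have h1 : (m : ℝ) / 3 ≤ m - 2 := by linarith
  calc (m : ℝ) ^ 3 / 3 = m * (m / 3) * m := by ring
    _ ≤ m * (m - 2) * (m + 3) := by
        have : (0 : ℝ) ≤ m - 2 := by linarith
        gcongr
        linarith

lemma isUnit_det_recMatrix {m : ℕ} (hm : 3 ≤ m) : IsUnit (recMatrix m).det := by
  rw [isUnit_iff_ne_zero, ← norm_pos_iff]
  refine lt_of_lt_of_le ?_ (norm_det_recMatrix_ge hm)
  have : (0 : ℝ) < m := by exact_mod_cast (by omega : 0 < m)
  positivity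

lemma norm_recMatrix_le {m : ℕ} (hm : 3 ≤ m) (i j : Fin 3) : ‖recMatrix m i j‖ ≤ 4 * m := by
  have hm' : (3 : ℝ) ≤ m := by exact_mod_cast hm
  have h1 : ‖-(m : ℂ) - 1‖ ≤ 4 * m := by
    refine (norm_sub_le _ _).trans ?_
    simp
    linarith
  fin_cases i <;> fin_cases j <;> simp [recMatrix] <;> first | exact h1 | linarith

lemma norm_adjugate_fin_three_le {A : Matrix (Fin 3) (Fin 3) ℂ} {a : ℝ} (ha : ∀ i j, ‖A i j‖ ≤ a)
    (i j : Fin 3) : ‖A.adjugate i j‖ ≤ 2 * a ^ 2 := by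
  have ha0 : 0 ≤ a := (norm_nonneg _).trans (ha 0 0)
  have hmul : ∀ i j k l, ‖A i j * A k l‖ ≤ a ^ 2 := fun i j k l => by
    rw [norm_mul, sq]
    exact mul_le_mul (ha _ _) (ha _ _) (norm_nonneg _) ha0
  have hsub : ∀ i j k l i' j' k' l', ‖A i j * A k l - A i' j' * A k' l'‖ ≤ 2 * a ^ 2 :=
    fun i j k l i' j' k' l' => (norm_sub_le _ _).trans (by
      linarith [hmul i j k l, hmul i' j' k' l'])
  have hadd : ∀ i j k l i' j' k' l', ‖-(A i j * A k l) + A i' j' * A k' l'‖ ≤ 2 * a ^ 2 :=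
    fun i j k l i' j' k' l' => by
      rw [neg_add_eq_sub]
      exact hsub _ _ _ _ _ _ _ _
  rw [Matrix.adjugate_fin_three]
  fin_cases i <;> fin_cases j <;> first | exact hsub _ _ _ _ _ _ _ _ | exact hadd _ _ _ _ _ _ _ _

/-- By Cramer's rule: the adjugate is quadratic in `m`, the determinant cubic. -/
lemma norm_inv_recMatrix_le {m : ℕ} (hm : 3 ≤ m) (i j : Fin 3) :
    ‖(recMatrix m)⁻¹ i j‖ ≤ 96 / m := by
  have hm0 : (0 : ℝ) < m := by exact_mod_cast (by omega : 0 < m)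
  have hadj := norm_adjugate_fin_three_le (norm_recMatrix_le hm) i j
  have hdet := norm_det_recMatrix_ge hm
  rw [Matrix.inv_def, Matrix.smul_apply, Ring.inverse_eq_inv', smul_eq_mul, norm_mul, norm_inv]
  calc ‖(recMatrix m).det‖⁻¹ * ‖(recMatrix m).adjugate i j‖
      ≤ ((m : ℝ) ^ 3 / 3)⁻¹ * (2 * (4 * m) ^ 2) := by gcongr
    _ = 96 / m := by field_simp; norm_num

lemma norm_pow_apply_le {A : Matrix (Fin 3) (Fin 3) ℂ} {a : ℝ} (ha : ∀ i j, ‖A i j‖ ≤ a)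
    (k : ℕ) (i j : Fin 3) : ‖(A ^ k) i j‖ ≤ (3 * a) ^ k := by
  have ha0 : 0 ≤ a := (norm_nonneg _).trans (ha 0 0)
  induction k generalizing i j with
  | zero =>
    rw [pow_zero, pow_zero, Matrix.one_apply]
    split_ifs <;> simp
  | succ k ih =>
    rw [pow_succ', Matrix.mul_apply]
    refine (norm_sum_le _ _).trans ?_
    calc ∑ l, ‖A i l * (A ^ k) l j‖ ≤ ∑ _l : Fin 3, a * (3 * a) ^ k := by
          refine Finset.sum_le_sum fun l _ => ?_
          rw [norm_mul]
          exact mul_le_mul (ha _ _) (ih _ _) (norm_nonneg _) ha0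
      _ = (3 * a) ^ (k + 1) := by simp; ring

/-! ### Solving the linear system with bounds -/

lemma absEval_mulVec_le {ρ : ℝ} (hρ : 0 ≤ ρ) {B : Matrix (Fin 3) (Fin 3) ℂ} {β f : ℝ}
    (hB : ∀ i j, ‖B i j‖ ≤ β) {V : Fin 3 → ℂ[X]} (hV : ∀ i, absEval ρ (V i) ≤ f) (i : Fin 3) :
    absEval ρ ((B.map Polynomial.C).mulVec V i) ≤ 3 * β * f := by
  have hβ : 0 ≤ β := (norm_nonneg _).trans (hB 0 0)
  rw [Matrix.mulVec, dotProduct]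
  refine (absEval_sum_le hρ _ _).trans ?_
  calc ∑ j, absEval ρ (B.map Polynomial.C i j * V j) ≤ ∑ _j : Fin 3, β * f := by
        refine Finset.sum_le_sum fun j _ => ?_
        rw [Matrix.map_apply, absEval_C_mul]
        exact mul_le_mul (hB _ _) (hV _) (absEval_nonneg hρ _) hβ
    _ = 3 * β * f := by simp; ring

lemma natDegree_mulVec_le {B : Matrix (Fin 3) (Fin 3) ℂ} {d : ℕ} {V : Fin 3 → ℂ[X]}
    (hV : ∀ i, (V i).natDegree ≤ d) (i : Fin 3) :
    ((B.map Polynomial.C).mulVec V i).natDegree ≤ d := by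
  rw [Matrix.mulVec, dotProduct]
  refine natDegree_sum_le_of_forall_le _ _ fun j _ => ?_
  rw [Matrix.map_apply]
  exact (natDegree_C_mul_le _ _).trans (hV j)

lemma natDegree_recSolve_le {m d : ℕ} {F : Fin 3 → ℂ[X]} (hF : ∀ i, (F i).natDegree ≤ d)
    (i : Fin 3) : (recSolve m F i).natDegree ≤ d := by
  rw [recSolve, Pi.neg_apply, natDegree_neg, Finset.sum_apply]
  exact natDegree_sum_le_of_forall_le _ _ fun j _ =>
    natDegree_mulVec_le (fun i => natDegree_iterate_derivative_le (hF i) j) i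

lemma absEval_recSolve_le {m : ℕ} (hm : 3 ≤ m) {F : Fin 3 → ℂ[X]}
    (hF : ∀ i, (F i).natDegree ≤ (m + 2) / 2) {f : ℝ} (hf : ∀ i, absEval 480 (F i) ≤ f)
    (i : Fin 3) : absEval 480 (recSolve m F i) ≤ 1728 / m * f := by
  have hm' : (3 : ℝ) ≤ m := by exact_mod_cast hm
  have hf0 : 0 ≤ f := (absEval_nonneg (by norm_num) _).trans (hf 0)
  -- For `m ≥ 3` one has `(m + 2) / 2 ≤ 5 m / 6`, and `480 * 6 / 5 = 576`.
  have hd : (((m + 2) / 2 : ℕ) : ℝ) / 480 ≤ m / 576 := by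
    have : (((m + 2) / 2 : ℕ) : ℝ) ≤ ((m + 2 : ℕ) : ℝ) / (2 : ℕ) := Nat.cast_div_le
    push_cast at this
    linarith
  rw [recSolve, Pi.neg_apply, absEval_neg, Finset.sum_apply]
  refine (absEval_sum_le (by norm_num) _ _).trans ?_
  calc _ ≤ ∑ j ∈ Finset.range ((m + 2) / 2 + 1), 864 / m * f * (1 / 2 : ℝ) ^ j := by
        refine Finset.sum_le_sum fun j _ => ?_
        refine (absEval_mulVec_le (by norm_num)
          (norm_pow_apply_le (norm_inv_recMatrix_le hm) (j + 1))
          (f := (m / 576) ^ j * f) (fun i => ?_) i).trans (le_of_eq ?_)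
        · refine (absEval_iterate_derivative_le (by norm_num) (hF i) j).trans ?_
          exact mul_le_mul (pow_le_pow_left₀ (by positivity) hd j) (hf i)
            (absEval_nonneg (by norm_num) _) (by positivity)
        -- The weight 480 is chosen for this: one more inverse and one more derivative together cost
        -- exactly `1/2`.
        · have : (1 / 2 : ℝ) = 3 * (96 / m) * (m / 576) := by field_simp; norm_num
          rw [this, mul_pow _ ((m : ℝ) / 576), pow_succ]
          ring
    _ = 864 / m * f * ∑ j ∈ Finset.range ((m + 2) / 2 + 1), (1 / 2 : ℝ) ^ j := by
        rw [Finset.mul_sum]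
    _ ≤ 864 / m * f * 2 := by
        gcongr
        exact sum_geometric_two_le _
    _ = 1728 / m * f := by ring

lemma derivative_mulVec (B : Matrix (Fin 3) (Fin 3) ℂ) (V : Fin 3 → ℂ[X]) (i : Fin 3) :
    derivative ((B.map Polynomial.C).mulVec V i) =
      (B.map Polynomial.C).mulVec (fun i => derivative (V i)) i := by
  simp [Matrix.mulVec, dotProduct]

/-- `recSolve m F` solves the linear system `X' = A_m X + F`. -/
lemma derivative_recSolve {m : ℕ} (hm : 3 ≤ m) {F : Fin 3 → ℂ[X]}
    (hF : ∀ i, (F i).natDegree ≤ (m + 2) / 2) (i : Fin 3) :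
    derivative (recSolve m F i) =
      ((recMatrix m).map Polynomial.C).mulVec (recSolve m F) i + F i := by
  set N := (m + 2) / 2 with hN
  -- The derivative shifts `T` up while `A_m` cancels one inverse, so the two sums telescope to `T 0
  -- = F`; the top term vanishes by the degree bound.
  let T : ℕ → Fin 3 → ℂ[X] := fun j =>
    (((recMatrix m)⁻¹ ^ j).map Polynomial.C).mulVec fun i => derivative^[j] (F i)
  have h1 : derivative (recSolve m F i) = -∑ j ∈ Finset.range (N + 1), T (j + 1) i := by
    rw [recSolve, Pi.neg_apply, derivative_neg, Finset.sum_apply, derivative_sum]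
    simp only [T, derivative_mulVec, Function.iterate_succ_apply']
    rfl
  have h2 : ((recMatrix m).map Polynomial.C).mulVec (recSolve m F) i =
      -∑ j ∈ Finset.range (N + 1), T j i := by
    rw [recSolve, Matrix.mulVec_neg, Pi.neg_apply, Matrix.mulVec_sum, Finset.sum_apply]
    refine congrArg Neg.neg (Finset.sum_congr rfl fun j _ => ?_)
    rw [Matrix.mulVec_mulVec, ← Matrix.map_mul, pow_succ', ← mul_assoc,
      Matrix.mul_nonsing_inv _ (isUnit_det_recMatrix hm), one_mul]
  have h3 : T (N + 1) i = 0 := by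
    have : (fun i => derivative^[N + 1] (F i)) = 0 := by
      funext i
      exact iterate_derivative_eq_zero (Nat.lt_succ_of_le (hF i))
    simp only [T, this, Matrix.mulVec_zero, Pi.zero_apply]
  have h4 : T 0 i = F i := by
    simp [T, Matrix.map_one]
  rw [h1, h2, Finset.sum_range_succ, h3, Finset.sum_range_succ', h4]
  ring

/-! ### Degrees of the coefficients and the system they satisfy -/

/-- The inhomogeneous term `F_m`, `m = k + 3`, of the recursion for the coefficients. -/
def forcing (D : ℂ) (k : ℕ) : Fin 3 → ℂ[X] :=
  ![-(10 * coeff D (k + 4) 0),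
    28 * coeff D (k + 3) 0 - coeff D (k + 4) 1
      - ∑ j : Fin (k + 4), coeff D ((j : ℕ) + 1) 0 * coeff D (k + 4 - (j : ℕ)) 2,
    -(Polynomial.C (8 / 3) * coeff D (k + 4) 2)
      + ∑ j : Fin (k + 4), coeff D ((j : ℕ) + 1) 0 * coeff D (k + 4 - (j : ℕ)) 1]

lemma coeff_add_five (D : ℂ) (k : ℕ) : coeff D (k + 5) = recSolve (k + 3) (forcing D k) := by
  rw [coeff, forcing]

lemma natDegree_quad_le {a₀ a₁ a₂ : ℂ} : (quad a₀ a₁ a₂).natDegree ≤ 2 := by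
  rw [quad]; compute_degree

lemma natDegree_quad_le_one {a₀ a₁ : ℂ} : (quad a₀ a₁ 0).natDegree ≤ 1 := by
  rw [quad]
  simp only [map_zero, zero_mul, add_zero]
  compute_degree

lemma natDegree_quad_le_zero {a₀ : ℂ} : (quad a₀ 0 0).natDegree ≤ 0 := by
  simp [quad]

lemma natDegree_natCast_mul_le {p : ℂ[X]} {d : ℕ} (n : ℕ) (hp : p.natDegree ≤ d) :
    ((n : ℂ[X]) * p).natDegree ≤ d := by
  rw [← C_eq_natCast]
  exact (natDegree_C_mul_le _ _).trans hp

/-- The indices in each product add up to `k + 5`, and halving with rounding down is superadditive.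
-/
lemma natDegree_forcing_le {D : ℂ} {k : ℕ}
    (ih : ∀ n < k + 5, ∀ i, (coeff D n i).natDegree ≤ n / 2) (i : Fin 3) :
    (forcing D k i).natDegree ≤ (k + 3 + 2) / 2 := by
  have hle : ∀ n ≤ k + 4, ∀ i, (coeff D n i).natDegree ≤ (k + 3 + 2) / 2 := fun n hn i =>
    (ih n (by omega) i).trans (by omega)
  have hsum : ∀ i : Fin 3, (∑ j : Fin (k + 4), coeff D ((j : ℕ) + 1) 0 *
      coeff D (k + 4 - (j : ℕ)) i).natDegree ≤ (k + 3 + 2) / 2 := fun i =>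
    natDegree_sum_le_of_forall_le _ _ fun j _ => by
      have h1 := ih ((j : ℕ) + 1) (by omega) 0
      have h2 := ih (k + 4 - (j : ℕ)) (by omega) i
      have h3 := natDegree_mul_le (p := coeff D ((j : ℕ) + 1) 0) (q := coeff D (k + 4 - (j : ℕ)) i)
      omega
  fin_cases i
  · change (-(10 * coeff D (k + 4) 0)).natDegree ≤ _
    rw [natDegree_neg]
    exact natDegree_natCast_mul_le 10 (hle _ (by omega) 0)
  · exact natDegree_sub_le_of_le (natDegree_sub_le_of_le
      (natDegree_natCast_mul_le 28 (hle _ (by omega) 0)) (hle _ (by omega) 1)) (hsum 2)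
      |>.trans (by simp)
  · refine (natDegree_add_le_of_degree_le (n := (k + 3 + 2) / 2) ?_ (hsum 1))
    rw [natDegree_neg]
    exact (natDegree_C_mul_le _ _).trans (hle _ (by omega) 2)

lemma natDegree_coeff_le (D : ℂ) (n : ℕ) (i : Fin 3) : (coeff D n i).natDegree ≤ n / 2 := by
  induction n using Nat.strong_induction_on generalizing i with
  | _ n ih =>
    match n, ih with
    | 0, _ => rw [coeff]; fin_cases i <;> exact natDegree_quad_le_zero
    | 1, _ => rw [coeff]; fin_cases i <;> exact natDegree_quad_le_zero
    | 2, _ => rw [coeff]; fin_cases i <;> exact natDegree_quad_le_one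
    | 3, _ => rw [coeff]; fin_cases i <;> exact natDegree_quad_le_one
    | 4, _ => rw [coeff]; fin_cases i <;> exact natDegree_quad_le
    | k + 5, ih =>
      rw [coeff_add_five]
      exact natDegree_recSolve_le (natDegree_forcing_le ih) i

/-- `shift k f` is the sequence `f` moved `k` places to the right. -/
def shift {α : Type*} [Zero α] (k : ℕ) (f : ℕ → α) (n : ℕ) : α := if k ≤ n then f (n - k) else 0

/-- The two end terms of the Cauchy product contain the unknown `coeff D (k + 5)`; they are the part
of the nonlinearity absorbed in the recursion matrix. -/
lemma sum_range_mul_coeff (D : ℂ) (k : ℕ) (i : Fin 3) :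
    ∑ j ∈ Finset.range (k + 5 + 1), coeff D j 0 * coeff D (k + 5 - j) i =
      coeff D 0 0 * coeff D (k + 5) i + coeff D (k + 5) 0 * coeff D 0 i +
        ∑ j : Fin (k + 4), coeff D ((j : ℕ) + 1) 0 * coeff D (k + 4 - (j : ℕ)) i := by
  rw [Finset.sum_range_succ, Finset.sum_range_succ', Nat.sub_self, Nat.sub_zero,
    Fin.sum_univ_eq_sum_range (fun j => coeff D (j + 1) 0 * coeff D (k + 4 - j) i)]
  simp only [show ∀ j, k + 5 - (j + 1) = k + 4 - j from fun j => by omega]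
  ring

lemma coeff_zero_eq (D : ℂ) : coeff D 0 =
    ![quad (2 * Complex.I) 0 0, quad (-Complex.I / 5) 0 0, quad (-1 / 5) 0 0] := by
  rw [coeff]

lemma coeff_add_five_system (D : ℂ) (k : ℕ) (i : Fin 3) :
    derivative (coeff D (k + 5) i) =
      ((recMatrix (k + 3)).map Polynomial.C).mulVec (coeff D (k + 5)) i + forcing D k i := by
  rw [coeff_add_five]
  exact derivative_recSolve (by omega)
    (natDegree_forcing_le fun n _ i => natDegree_coeff_le D n i) i

/-- The coefficient of one power of `t - t₀` in the first Lorenz equation. The explicit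
coefficients, resonances included, are checked directly; from index 5 on it is a row of the linear
system. -/
lemma eval_derivative_coeff_x (D : ℂ) (n : ℕ) (s : ℂ) :
    (derivative (coeff D n 0)).eval s + ((n : ℂ) - 1) * (coeff D n 0).eval s =
      10 * ((coeff D n 1).eval s - shift 1 (fun n => (coeff D n 0).eval s) n) := by
  match n with
  | 0 | 1 | 2 | 3 | 4 => simp [coeff, quad, shift]; try ring
  | k + 5 =>
    rw [coeff_add_five_system, forcing]
    simp [recMatrix, Matrix.mulVec, dotProduct, Fin.sum_univ_three, shift]
    ring

lemma eval_derivative_coeff_y (D : ℂ) (n : ℕ) (s : ℂ) :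
    (derivative (coeff D n 1)).eval s + ((n : ℂ) - 2) * (coeff D n 1).eval s =
      28 * shift 2 (fun n => (coeff D n 0).eval s) n - shift 1 (fun n => (coeff D n 1).eval s) n -
        ∑ j ∈ Finset.range (n + 1), (coeff D j 0).eval s * (coeff D (n - j) 2).eval s := by
  match n with
  | 0 | 1 | 2 | 3 | 4 =>
    simp [coeff, quad, shift, Finset.sum_range_succ]
    ring_nf
  | k + 5 =>
    have h := congrArg (Polynomial.eval s) (sum_range_mul_coeff D k 2)
    simp only [eval_finsetSum, eval_mul, eval_add] at h
    rw [h, coeff_add_five_system, forcing]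
    simp [recMatrix, Matrix.mulVec, dotProduct, Fin.sum_univ_three, shift, eval_finsetSum,
      coeff_zero_eq]
    simp only [quad]
    simp
    ring

lemma eval_derivative_coeff_z (D : ℂ) (n : ℕ) (s : ℂ) :
    (derivative (coeff D n 2)).eval s + ((n : ℂ) - 2) * (coeff D n 2).eval s =
      -8 / 3 * shift 1 (fun n => (coeff D n 2).eval s) n +
        ∑ j ∈ Finset.range (n + 1), (coeff D j 0).eval s * (coeff D (n - j) 1).eval s := by
  match n with
  | 0 | 1 | 2 | 3 | 4 =>
    simp [coeff, quad, shift, Finset.sum_range_succ]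
    ring_nf
    try (simp only [Complex.I_sq]; ring)
  | k + 5 =>
    have h := congrArg (Polynomial.eval s) (sum_range_mul_coeff D k 1)
    simp only [eval_finsetSum, eval_mul, eval_add] at h
    rw [h, coeff_add_five_system, forcing]
    simp [recMatrix, Matrix.mulVec, dotProduct, Fin.sum_univ_three, shift, eval_finsetSum,
      coeff_zero_eq]
    simp only [quad]
    simp
    ring

/-! ### Geometric growth of the coefficients -/

lemma absEval_forcing_le {D : ℂ} {k : ℕ} {δ M : ℝ} (hδ : 0 ≤ δ) (hM : 1 ≤ M)
    (ih : ∀ n, 1 ≤ n → n < k + 5 → ∀ i, absEval 480 (coeff D n i) ≤ δ * M ^ n) (i : Fin 3) :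
    absEval 480 (forcing D k i) ≤ 58 * (δ * M ^ (k + 4)) + (k + 4) * (δ ^ 2 * M ^ (k + 5)) := by
  have hρ : (0 : ℝ) ≤ 480 := by norm_num
  have h3 : δ * M ^ (k + 3) ≤ δ * M ^ (k + 4) := by gcongr; omega
  have hx3 := ih (k + 3) (by omega) (by omega) 0
  have h4 := ih (k + 4) (by omega) (by omega)
  have hsum : ∀ i : Fin 3, absEval 480 (∑ j : Fin (k + 4), coeff D ((j : ℕ) + 1) 0 *
      coeff D (k + 4 - (j : ℕ)) i) ≤ (k + 4) * (δ ^ 2 * M ^ (k + 5)) := fun i => by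
    refine (absEval_sum_le hρ _ _).trans ?_
    calc _ ≤ ∑ _j : Fin (k + 4), δ ^ 2 * M ^ (k + 5) := by
          refine Finset.sum_le_sum fun j _ => (absEval_mul_le hρ _ _).trans ?_
          calc _ ≤ (δ * M ^ ((j : ℕ) + 1)) * (δ * M ^ (k + 4 - (j : ℕ))) :=
                mul_le_mul (ih _ (by omega) (by omega) 0) (ih _ (by omega) (by omega) i)
                  (absEval_nonneg hρ _) (by positivity)
            _ = δ ^ 2 * M ^ (k + 5) := by
                rw [show k + 5 = ((j : ℕ) + 1) + (k + 4 - (j : ℕ)) by omega, pow_add]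
                ring
      _ = (k + 4) * (δ ^ 2 * M ^ (k + 5)) := by simp
  have hnat : ∀ (n : ℕ) (p : ℂ[X]), absEval 480 ((n : ℂ[X]) * p) = n * absEval 480 p :=
      fun n p => by
    rw [← C_eq_natCast, absEval_C_mul, Complex.norm_natCast]
  have hpos : 0 ≤ (k + 4) * (δ ^ 2 * M ^ (k + 5)) := by positivity
  have hpos' : 0 ≤ δ * M ^ (k + 4) := by positivity
  fin_cases i
  · change absEval 480 (-(((10 : ℕ) : ℂ[X]) * coeff D (k + 4) 0)) ≤ _
    rw [absEval_neg, hnat]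
    push_cast
    linarith [h4 0]
  · refine (absEval_sub_le hρ _ _).trans (add_le_add ((absEval_sub_le hρ _ _).trans ?_) (hsum 2))
    change absEval 480 (((28 : ℕ) : ℂ[X]) * coeff D (k + 3) 0) + _ ≤ _
    rw [hnat]
    push_cast
    linarith [h4 1]
  · refine (absEval_add_le hρ _ _).trans (add_le_add ?_ (hsum 1))
    rw [absEval_neg, absEval_C_mul]
    have : ‖(8 / 3 : ℂ)‖ = 8 / 3 := by norm_num
    rw [this]
    linarith [h4 2]

lemma exists_absEval_coeff_le (D : ℂ) :
    ∃ K M : ℝ, 0 < K ∧ 1 ≤ M ∧ ∀ n i, absEval 480 (coeff D n i) ≤ K * M ^ n := by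
  have hρ : (0 : ℝ) ≤ 480 := by norm_num
  let S : ℝ := ∑ n ∈ Finset.range 5, ∑ i, absEval 480 (coeff D n i)
  have hS : ∀ n < 5, ∀ i, absEval 480 (coeff D n i) ≤ S := fun n hn i =>
    (Finset.single_le_sum (f := fun i => absEval 480 (coeff D n i))
      (fun i _ => absEval_nonneg hρ _) (Finset.mem_univ i)).trans
    (Finset.single_le_sum (f := fun n => ∑ i, absEval 480 (coeff D n i))
      (fun n _ => Finset.sum_nonneg fun i _ => absEval_nonneg hρ _) (Finset.mem_range.mpr hn))
  have hS0 : 0 ≤ S := (absEval_nonneg hρ _).trans (hS 0 (by norm_num) 0)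
  -- The convolution is quadratic in `δ`, so a small `δ` absorbs it: `1728 * δ = 3/8`. Index 0 need
  -- not be small, as `forcing` does not involve it.
  obtain ⟨δ, hδ⟩ : ∃ δ : ℝ, δ = 1 / 4608 := ⟨_, rfl⟩
  have hδ0 : 0 < δ := by rw [hδ]; norm_num
  -- Here `66816 = 1728 * 58 * 2 / 3`, so the linear terms contribute at most `3/2` and the
  -- convolution `3/8 * (k + 4)`, in total at most `k + 3`. The summand `4608 * S` gives `S ≤ δ * M`
  -- for the initial coefficients.
  obtain ⟨M, hM⟩ : ∃ M : ℝ, M = 66816 + 4608 * S := ⟨_, rfl⟩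
  have hM1 : 1 ≤ M := by linarith
  have key : ∀ n, 1 ≤ n → ∀ i, absEval 480 (coeff D n i) ≤ δ * M ^ n := by
    intro n
    induction n using Nat.strong_induction_on with
    | _ n ih =>
      intro hn i
      rcases Nat.lt_or_ge n 5 with h5 | h5
      · calc absEval 480 (coeff D n i) ≤ S := hS n h5 i
          _ ≤ δ * M ^ 1 := by rw [hδ, hM]; linarith
          _ ≤ δ * M ^ n := by gcongr
      · obtain ⟨k, rfl⟩ := Nat.exists_eq_add_of_le' h5
        rw [coeff_add_five]
        refine (absEval_recSolve_le (by omega) (natDegree_forcing_le fun n _ i =>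
          natDegree_coeff_le D n i) (absEval_forcing_le hδ0.le hM1 fun n h1 h2 => ih n h2 h1)
          i).trans ?_
        have hk : (3 : ℝ) ≤ ((k + 3 : ℕ) : ℝ) := by push_cast; linarith [Nat.cast_nonneg (α := ℝ) k]
        have hk0 : (0 : ℝ) < ((k + 3 : ℕ) : ℝ) := by linarith
        rw [div_mul_eq_mul_div, div_le_iff₀ hk0]
        have h1 : 66816 * (δ * M ^ (k + 4)) ≤ δ * M ^ (k + 5) := by
          rw [pow_succ M (k + 4)]
          have : 0 ≤ δ * M ^ (k + 4) := by positivity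
          nlinarith
        have h2 : δ ^ 2 * M ^ (k + 5) = δ * M ^ (k + 5) / 4608 := by rw [hδ]; ring
        have h3 : 0 ≤ δ * M ^ (k + 5) := by positivity
        rw [h2]
        push_cast at hk ⊢
        nlinarith [mul_nonneg h3 (Nat.cast_nonneg (α := ℝ) k)]
  refine ⟨S + δ, M, by linarith, hM1, fun n i => ?_⟩
  rcases Nat.eq_zero_or_pos n with rfl | hn
  · rw [pow_zero]
    linarith [hS 0 (by norm_num) i]
  · refine (key n hn i).trans ?_
    gcongr
    linarith

/-! ### The majorant near the singular point -/

/-- The constant that controls `‖η + C‖` through `‖η + C‖ ≤ logBound C + |log ‖t - t₀‖|`. -/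
def logBound (C : ℂ) : ℝ := 1 + Real.pi + ‖C‖

/-- The ratio of the geometric series that dominates the psi series at distance `x` from `t₀`. -/
def gauge (C : ℂ) (M x : ℝ) : ℝ := M * (logBound C + |Real.log x|) * x

lemma one_le_logBound (C : ℂ) : 1 ≤ logBound C := by
  have := Real.pi_pos
  have := norm_nonneg C
  rw [logBound]
  linarith

lemma gauge_nonneg (C : ℂ) {M x : ℝ} (hM : 1 ≤ M) (hx : 0 ≤ x) : 0 ≤ gauge C M x := by
  have := one_le_logBound C
  rw [gauge]
  positivity

/-- Write `x` as the `N`-th power of `x ^ (1 / N)`; the logarithm times any positive power of `x`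
tends to 0. -/
lemma tendsto_add_abs_log_pow_mul (κ : ℝ) {N : ℕ} (hN : N ≠ 0) :
    Filter.Tendsto (fun x : ℝ => (κ + |Real.log x|) ^ N * x) (nhdsWithin 0 (Set.Ioi 0))
      (nhds 0) := by
  have hN' : (0 : ℝ) < 1 / N := by positivity
  have h1 : Filter.Tendsto (fun x : ℝ => x ^ (1 / N : ℝ)) (nhdsWithin 0 (Set.Ioi 0)) (nhds 0) := by
    have := (Real.continuousAt_rpow_const 0 (1 / N : ℝ) (Or.inr hN'.le)).tendsto
    rw [Real.zero_rpow hN'.ne'] at this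
    exact this.mono_left nhdsWithin_le_nhds
  have h2 := (tendsto_log_mul_rpow_nhdsGT_zero hN').abs
  have h3 := ((h1.const_mul κ).add h2).pow N
  simp only [mul_zero, abs_zero, add_zero, zero_pow hN] at h3
  refine h3.congr' ?_
  filter_upwards [self_mem_nhdsWithin] with x hx
  have hx0 : 0 ≤ x := le_of_lt hx
  rw [abs_mul, abs_of_nonneg (Real.rpow_nonneg hx0 _), ← add_mul, mul_pow, one_div,
    Real.rpow_inv_natCast_pow hx0 hN]

lemma tendsto_gauge (C : ℂ) (M : ℝ) :
    Filter.Tendsto (gauge C M) (nhdsWithin 0 (Set.Ioi 0)) (nhds 0) := by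
  have h := (tendsto_add_abs_log_pow_mul (logBound C) one_ne_zero).const_mul M
  simp only [pow_one, mul_zero] at h
  exact h.congr fun x => by rw [gauge, mul_assoc]

lemma mem_slitPlane_of_notMem_branchCut {b t₀ t : ℂ} (hb : ‖b‖ = 1) (ht : t ∉ branchCut b t₀) :
    b * (t - t₀) ∈ Complex.slitPlane := by
  by_contra h
  rw [Complex.mem_slitPlane_iff, not_or, not_lt, not_not] at h
  refine ht ⟨-(b * (t - t₀)).re, by linarith [h.1], ?_⟩
  have hre : (((b * (t - t₀)).re : ℝ) : ℂ) = b * (t - t₀) := Complex.ext (by simp) (by simp [h.2])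
  have hbb : (starRingEnd ℂ) b * b = 1 := by
    rw [mul_comm, Complex.mul_conj, Complex.normSq_eq_norm_sq, hb]
    simp
  push_cast
  rw [hre]
  linear_combination (t₀ - t) * hbb

lemma sub_ne_zero_of_mem_slitPlane {b t₀ t : ℂ} (ht : b * (t - t₀) ∈ Complex.slitPlane) :
    t - t₀ ≠ 0 := fun h => Complex.slitPlane_ne_zero ht (by rw [h, mul_zero])

lemma norm_etaC_le {b t₀ C t : ℂ} (hb : ‖b‖ = 1) :
    ‖etaC b t₀ C t‖ + 1 ≤ logBound C + |Real.log ‖t - t₀‖| := by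
  have h1 := Complex.norm_le_abs_re_add_abs_im (Complex.log (b * (t - t₀)))
  rw [Complex.log_re, Complex.log_im, norm_mul, hb, one_mul] at h1
  have h2 := Complex.abs_arg_le_pi (b * (t - t₀))
  have h3 := norm_add_le (Complex.log (b * (t - t₀))) C
  rw [etaC, logBound]
  linarith

/-- The terms of the psi series without the sign `ε`; the exponent of the leading term is `-k`. -/
def psiTerm (i : Fin 3) (k : ℕ) (b t₀ C D t : ℂ) (n : ℕ) : ℂ :=
  (coeff D n i).eval (etaC b t₀ C t) * (t - t₀) ^ ((n : ℤ) - k)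

def psiSum (i : Fin 3) (k : ℕ) (b t₀ C D t : ℂ) : ℂ := ∑' n, psiTerm i k b t₀ C D t n

lemma xTerm_eq (ε b t₀ C D t : ℂ) (n : ℕ) :
    xTerm ε b t₀ C D t n = ε * psiTerm 0 1 b t₀ C D t n := by
  simp [xTerm, psiTerm, mul_assoc]

lemma yTerm_eq (ε b t₀ C D t : ℂ) (n : ℕ) :
    yTerm ε b t₀ C D t n = ε * psiTerm 1 2 b t₀ C D t n := by
  simp [yTerm, psiTerm, mul_assoc]

lemma zTerm_eq (b t₀ C D t : ℂ) (n : ℕ) : zTerm b t₀ C D t n = psiTerm 2 2 b t₀ C D t n := by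
  simp [zTerm, psiTerm]

lemma psiX_eq (ε b t₀ C D t : ℂ) : psiX ε b t₀ C D t = ε * psiSum 0 1 b t₀ C D t := by
  simp_rw [psiX, psiSum, xTerm_eq, tsum_mul_left]

lemma psiY_eq (ε b t₀ C D t : ℂ) : psiY ε b t₀ C D t = ε * psiSum 1 2 b t₀ C D t := by
  simp_rw [psiY, psiSum, yTerm_eq, tsum_mul_left]

lemma psiZ_eq (b t₀ C D t : ℂ) : psiZ b t₀ C D t = psiSum 2 2 b t₀ C D t := by
  simp_rw [psiZ, psiSum, zTerm_eq]

/-- The psi series are dominated by geometric series with ratio `gauge C M ‖t - t₀‖`. -/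
def Dominates (C D : ℂ) (K M : ℝ) : Prop :=
  ∀ (i : Fin 3) (k : ℕ) (b t₀ t : ℂ) (n : ℕ), ‖b‖ = 1 → b * (t - t₀) ∈ Complex.slitPlane →
    ‖psiTerm i k b t₀ C D t n‖ ≤ K * gauge C M ‖t - t₀‖ ^ n / ‖t - t₀‖ ^ k

lemma exists_dominates (C D : ℂ) : ∃ K M : ℝ, 0 < K ∧ 1 ≤ M ∧ Dominates C D K M := by
  obtain ⟨K, M, hK, hM, h⟩ := exists_absEval_coeff_le D
  refine ⟨K, M, hK, hM, fun i k b t₀ t n hb ht => ?_⟩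
  have hu := sub_ne_zero_of_mem_slitPlane ht
  have hu' : 0 < ‖t - t₀‖ := norm_pos_iff.mpr hu
  have hη := norm_etaC_le (t₀ := t₀) (C := C) (t := t) hb
  have hη0 := norm_nonneg (etaC b t₀ C t)
  set l := logBound C + |Real.log ‖t - t₀‖| with hl
  have hl1 : 1 ≤ l := by linarith
  have he : ‖(coeff D n i).eval (etaC b t₀ C t)‖ ≤ K * M ^ n * l ^ n := by
    refine (norm_eval_le_absEval (ρ := 480) (by norm_num)
      ((natDegree_coeff_le D n i).trans (Nat.div_le_self n 2)) hl1 (by linarith)).trans ?_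
    gcongr
    exact h n i
  rw [psiTerm, norm_mul, norm_zpow, zpow_sub₀ hu'.ne', zpow_natCast, zpow_natCast, gauge, ← hl]
  calc _ ≤ K * M ^ n * l ^ n * (‖t - t₀‖ ^ n / ‖t - t₀‖ ^ k) := by gcongr
    _ = _ := by rw [mul_pow, mul_pow]; ring

section Dominated

variable {C D : ℂ} {K M : ℝ} {b t₀ t : ℂ} {i : Fin 3} {k : ℕ}

lemma Dominates.norm_psiTerm_le (hd : Dominates C D K M) (hK : 0 < K) (hM : 1 ≤ M)
    (hb : ‖b‖ = 1) (ht : b * (t - t₀) ∈ Complex.slitPlane)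
    (hg : gauge C M ‖t - t₀‖ ≤ 1 / 2) (n : ℕ) :
    ‖psiTerm i k b t₀ C D t n‖ ≤ K / ‖t - t₀‖ ^ k * (1 / 2) ^ n := by
  have hg0 := gauge_nonneg C hM (norm_nonneg (t - t₀))
  calc _ ≤ K * gauge C M ‖t - t₀‖ ^ n / ‖t - t₀‖ ^ k := hd i k b t₀ t n hb ht
    _ ≤ K * (1 / 2) ^ n / ‖t - t₀‖ ^ k := by gcongr
    _ = _ := by ring

lemma Dominates.summable (hd : Dominates C D K M) (hK : 0 < K) (hM : 1 ≤ M)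
    (hb : ‖b‖ = 1) (ht : b * (t - t₀) ∈ Complex.slitPlane)
    (hg : gauge C M ‖t - t₀‖ ≤ 1 / 2) : Summable fun n => ‖psiTerm i k b t₀ C D t n‖ :=
  Summable.of_nonneg_of_le (fun _ => norm_nonneg _) (hd.norm_psiTerm_le hK hM hb ht hg)
    (summable_geometric_two.mul_left _)

lemma Dominates.norm_psiSum_sub_le (hd : Dominates C D K M) (hK : 0 < K) (hM : 1 ≤ M)
    (hb : ‖b‖ = 1) (ht : b * (t - t₀) ∈ Complex.slitPlane)
    (hg : gauge C M ‖t - t₀‖ ≤ 1 / 2) (N : ℕ) :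
    ‖psiSum i k b t₀ C D t - ∑ n ∈ Finset.range N, psiTerm i k b t₀ C D t n‖ ≤
      2 * K * gauge C M ‖t - t₀‖ ^ N / ‖t - t₀‖ ^ k := by
  have hg0 := gauge_nonneg C hM (norm_nonneg (t - t₀))
  have hs : Summable fun n => psiTerm i k b t₀ C D t n := (hd.summable hK hM hb ht hg).of_norm
  rw [psiSum, ← hs.sum_add_tsum_nat_add N, add_sub_cancel_left]
  have hgeo := (hasSum_geometric_two).mul_left (K * gauge C M ‖t - t₀‖ ^ N / ‖t - t₀‖ ^ k)
  refine (tsum_of_norm_bounded hgeo fun n => ?_).trans (le_of_eq (by ring))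
  calc _ ≤ K * gauge C M ‖t - t₀‖ ^ (n + N) / ‖t - t₀‖ ^ k := hd i k b t₀ t (n + N) hb ht
    _ = K * gauge C M ‖t - t₀‖ ^ N / ‖t - t₀‖ ^ k * gauge C M ‖t - t₀‖ ^ n := by
        rw [pow_add]; ring
    _ ≤ _ := by gcongr

/-! ### Termwise differentiation -/

lemma hasDerivAt_psiTerm (ht : b * (t - t₀) ∈ Complex.slitPlane) (n : ℕ) :
    HasDerivAt (fun w => psiTerm i k b t₀ C D w n)
      (((derivative (coeff D n i)).eval (etaC b t₀ C t) +
        ((n : ℂ) - k) * (coeff D n i).eval (etaC b t₀ C t)) *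
          (t - t₀) ^ ((n : ℤ) - (k + 1 : ℕ))) t := by
  have hu := sub_ne_zero_of_mem_slitPlane ht
  have hb : b ≠ 0 := fun h => Complex.slitPlane_ne_zero ht (by rw [h, zero_mul])
  have h1 : HasDerivAt (fun w => w - t₀) 1 t := (hasDerivAt_id t).sub_const t₀
  have h2 : HasDerivAt (fun w => etaC b t₀ C w) (b * 1 / (b * (t - t₀))) t :=
    ((h1.const_mul b).clog ht).add_const C
  have h3 := ((coeff D n i).hasDerivAt (etaC b t₀ C t)).comp t h2
  have h4 := (hasDerivAt_zpow ((n : ℤ) - k) (t - t₀) (Or.inl hu)).comp t h1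
  refine (h3.mul h4).congr_deriv ?_
  have h5 : (t - t₀) ^ ((n : ℤ) - (k + 1 : ℕ)) = (t - t₀) ^ ((n : ℤ) - k - 1) := by
    congr 1; push_cast; ring
  have h6 : (t - t₀) ^ ((n : ℤ) - k) = (t - t₀) ^ ((n : ℤ) - k - 1) * (t - t₀) := by
    rw [← zpow_add_one₀ hu]; congr 1; ring
  simp only [Function.comp_apply]
  rw [h5, h6]
  push_cast
  field_simp

lemma Dominates.exists_hasDerivAt_psiSum (hd : Dominates C D K M) (hK : 0 < K) (hM : 1 ≤ M)
    {R : ℝ} (hR : ∀ x, 0 < x → x < R → gauge C M x ≤ 1 / 2)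
    (hb : ‖b‖ = 1) (ht : b * (t - t₀) ∈ Complex.slitPlane) (htR : ‖t - t₀‖ < R) :
    ∃ d, HasDerivAt (psiSum i k b t₀ C D) d t ∧
      HasSum (fun n : ℕ => ((derivative (coeff D n i)).eval (etaC b t₀ C t) +
        ((n : ℂ) - k) * (coeff D n i).eval (etaC b t₀ C t)) *
          (t - t₀) ^ ((n : ℤ) - (k + 1 : ℕ))) d := by
  have hu : 0 < ‖t - t₀‖ := norm_pos_iff.mpr (sub_ne_zero_of_mem_slitPlane ht)
  -- Keeping `w` away from `t₀` bounds the pole factor `1 / ‖w - t₀‖ ^ k` uniformly, so that the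
  -- Weierstrass theorem applies on `U`.
  let U : Set ℂ := {w | b * (w - t₀) ∈ Complex.slitPlane} ∩
    ({w | ‖t - t₀‖ / 2 < ‖w - t₀‖} ∩ {w | ‖w - t₀‖ < R})
  have hU : IsOpen U :=
    (Complex.isOpen_slitPlane.preimage (by fun_prop)).inter
      ((isOpen_lt continuous_const (by fun_prop)).inter (isOpen_lt (by fun_prop) continuous_const))
  have htU : t ∈ U := ⟨ht, half_lt_self hu, htR⟩
  have hdiff : ∀ n, DifferentiableOn ℂ (fun w => psiTerm i k b t₀ C D w n) U := fun n w hw =>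
    (hasDerivAt_psiTerm hw.1 n).differentiableAt.differentiableWithinAt
  have hle : ∀ (n : ℕ) (w : ℂ), w ∈ U →
      ‖psiTerm i k b t₀ C D w n‖ ≤ K / (‖t - t₀‖ / 2) ^ k * (1 / 2) ^ n := fun n w hw => by
    have hw0 : ‖t - t₀‖ / 2 < ‖w - t₀‖ := hw.2.1
    refine (hd.norm_psiTerm_le hK hM hb hw.1 (hR _ (by linarith) hw.2.2) n).trans ?_
    gcongr
  have hsum : Summable fun n : ℕ => K / (‖t - t₀‖ / 2) ^ k * (1 / 2 : ℝ) ^ n :=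
    summable_geometric_two.mul_left _
  refine ⟨deriv (psiSum i k b t₀ C D) t, ?_, ?_⟩
  · exact ((Complex.differentiableOn_tsum_of_summable_norm hsum hdiff hU hle).differentiableAt
      (hU.mem_nhds htU)).hasDerivAt
  · refine (Complex.hasSum_deriv_of_summable_norm hsum hdiff hU hle htU).congr_fun fun n => ?_
    exact ((hasDerivAt_psiTerm ht n).deriv).symm

end Dominated

/-! ### The sums satisfy the Lorenz system -/

lemma hasSum_shift {f : ℕ → ℂ} {a : ℂ} (hf : HasSum f a) (k : ℕ) : HasSum (shift k f) a := by
  refine ((add_left_injective k).hasSum_iff fun n hn => ?_).mp ?_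
  · rw [shift, if_neg]
    exact fun h => hn ⟨n - k, Nat.sub_add_cancel h⟩
  · rwa [show shift k f ∘ (fun n => n + k) = f from funext fun n => by simp [shift]]

lemma shift_psiTerm (i : Fin 3) (k j : ℕ) (b t₀ C D t : ℂ) (n : ℕ) :
    shift j (psiTerm i k b t₀ C D t) n =
      shift j (fun n => (coeff D n i).eval (etaC b t₀ C t)) n *
        (t - t₀) ^ ((n : ℤ) - (k + j : ℕ)) := by
  by_cases h : j ≤ n
  · rw [shift, shift, if_pos h, if_pos h, psiTerm]
    congr 2
    push_cast [h]
    ring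
  · rw [shift, shift, if_neg h, if_neg h, zero_mul]

lemma sum_range_psiTerm_mul {i i' : Fin 3} {k k' : ℕ} {b t₀ C D t : ℂ} (hu : t - t₀ ≠ 0) (n : ℕ) :
    ∑ j ∈ Finset.range (n + 1), psiTerm i k b t₀ C D t j * psiTerm i' k' b t₀ C D t (n - j) =
      (∑ j ∈ Finset.range (n + 1), (coeff D j i).eval (etaC b t₀ C t) *
        (coeff D (n - j) i').eval (etaC b t₀ C t)) * (t - t₀) ^ ((n : ℤ) - (k + k' : ℕ)) := by
  rw [Finset.sum_mul]
  refine Finset.sum_congr rfl fun j hj => ?_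
  have hj' : j ≤ n := Nat.lt_succ_iff.mp (Finset.mem_range.mp hj)
  rw [psiTerm, psiTerm, mul_mul_mul_comm, ← zpow_add₀ hu]
  congr 2
  push_cast [hj']
  ring

section Dominated

variable {C D : ℂ} {K M : ℝ} {b t₀ t : ℂ}

lemma Dominates.hasDerivAt_psiSum_x (hd : Dominates C D K M) (hK : 0 < K) (hM : 1 ≤ M)
    {R : ℝ} (hR : ∀ x, 0 < x → x < R → gauge C M x ≤ 1 / 2)
    (hb : ‖b‖ = 1) (ht : b * (t - t₀) ∈ Complex.slitPlane) (htR : ‖t - t₀‖ < R) :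
    HasDerivAt (psiSum 0 1 b t₀ C D)
      (10 * (psiSum 1 2 b t₀ C D t - psiSum 0 1 b t₀ C D t)) t := by
  have hu : 0 < ‖t - t₀‖ := norm_pos_iff.mpr (sub_ne_zero_of_mem_slitPlane ht)
  have hg := hR _ hu htR
  obtain ⟨d, hder, hsum⟩ := hd.exists_hasDerivAt_psiSum (i := 0) (k := 1) hK hM hR hb ht htR
  have hx := (hd.summable (i := 0) (k := 1) hK hM hb ht hg).of_norm.hasSum
  have hy := (hd.summable (i := 1) (k := 2) hK hM hb ht hg).of_norm.hasSum
  have hrhs := (hy.sub (hasSum_shift hx 1)).mul_left 10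
  convert hder using 1
  refine hrhs.unique (hsum.congr_fun fun n => ?_)
  have h := eval_derivative_coeff_x D n (etaC b t₀ C t)
  rw [shift_psiTerm, psiTerm, Nat.cast_one, h]
  push_cast
  ring

lemma Dominates.hasDerivAt_psiSum_y (hd : Dominates C D K M) (hK : 0 < K) (hM : 1 ≤ M)
    {R : ℝ} (hR : ∀ x, 0 < x → x < R → gauge C M x ≤ 1 / 2)
    (hb : ‖b‖ = 1) (ht : b * (t - t₀) ∈ Complex.slitPlane) (htR : ‖t - t₀‖ < R) :
    HasDerivAt (psiSum 1 2 b t₀ C D)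
      (28 * psiSum 0 1 b t₀ C D t - psiSum 1 2 b t₀ C D t -
        psiSum 0 1 b t₀ C D t * psiSum 2 2 b t₀ C D t) t := by
  have hu0 := sub_ne_zero_of_mem_slitPlane ht
  have hg := hR _ (norm_pos_iff.mpr hu0) htR
  obtain ⟨d, hder, hsum⟩ := hd.exists_hasDerivAt_psiSum (i := 1) (k := 2) hK hM hR hb ht htR
  have hxn := hd.summable (i := 0) (k := 1) hK hM hb ht hg
  have hx := hxn.of_norm.hasSum
  have hy := (hd.summable (i := 1) (k := 2) hK hM hb ht hg).of_norm.hasSum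
  have hzn := hd.summable (i := 2) (k := 2) hK hM hb ht hg
  have hrhs := (((hasSum_shift hx 2).mul_left 28).sub (hasSum_shift hy 1)).sub
    (hasSum_sum_range_mul_of_summable_norm hxn hzn)
  convert hder using 1
  refine hrhs.unique (hsum.congr_fun fun n => ?_)
  have h := eval_derivative_coeff_y D n (etaC b t₀ C t)
  rw [shift_psiTerm, shift_psiTerm, sum_range_psiTerm_mul hu0, Nat.cast_ofNat, h]
  push_cast
  ring

lemma Dominates.hasDerivAt_psiSum_z (hd : Dominates C D K M) (hK : 0 < K) (hM : 1 ≤ M)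
    {R : ℝ} (hR : ∀ x, 0 < x → x < R → gauge C M x ≤ 1 / 2)
    (hb : ‖b‖ = 1) (ht : b * (t - t₀) ∈ Complex.slitPlane) (htR : ‖t - t₀‖ < R) :
    HasDerivAt (psiSum 2 2 b t₀ C D)
      (-8 / 3 * psiSum 2 2 b t₀ C D t + psiSum 0 1 b t₀ C D t * psiSum 1 2 b t₀ C D t) t := by
  have hu0 := sub_ne_zero_of_mem_slitPlane ht
  have hg := hR _ (norm_pos_iff.mpr hu0) htR
  obtain ⟨d, hder, hsum⟩ := hd.exists_hasDerivAt_psiSum (i := 2) (k := 2) hK hM hR hb ht htR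
  have hxn := hd.summable (i := 0) (k := 1) hK hM hb ht hg
  have hyn := hd.summable (i := 1) (k := 2) hK hM hb ht hg
  have hz := (hd.summable (i := 2) (k := 2) hK hM hb ht hg).of_norm.hasSum
  have hrhs := ((hasSum_shift hz 1).mul_left (-8 / 3)).add
    (hasSum_sum_range_mul_of_summable_norm hxn hyn)
  convert hder using 1
  refine hrhs.unique (hsum.congr_fun fun n => ?_)
  have h := eval_derivative_coeff_z D n (etaC b t₀ C t)
  rw [shift_psiTerm, sum_range_psiTerm_mul hu0, Nat.cast_ofNat, h]
  push_cast
  norm_num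
  ring

/-- The sign is harmless because of the symmetry `(x, y, z) ↦ (-x, -y, z)` of the system. -/
lemma Dominates.satisfiesLorenzAt (hd : Dominates C D K M) (hK : 0 < K) (hM : 1 ≤ M)
    {R : ℝ} (hR : ∀ x, 0 < x → x < R → gauge C M x ≤ 1 / 2) {ε : ℂ} (hε : ε * ε = 1)
    (hb : ‖b‖ = 1) (ht : b * (t - t₀) ∈ Complex.slitPlane) (htR : ‖t - t₀‖ < R) :
    SatisfiesLorenzAt (psiX ε b t₀ C D) (psiY ε b t₀ C D) (psiZ b t₀ C D) t := by
  rw [funext (psiX_eq ε b t₀ C D), funext (psiY_eq ε b t₀ C D), funext (psiZ_eq b t₀ C D)]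
  refine ⟨?_, ?_, ?_⟩
  · refine ((hd.hasDerivAt_psiSum_x hK hM hR hb ht htR).const_mul ε).congr_deriv ?_
    ring
  · refine ((hd.hasDerivAt_psiSum_y hK hM hR hb ht htR).const_mul ε).congr_deriv ?_
    ring
  · refine (hd.hasDerivAt_psiSum_z hK hM hR hb ht htR).congr_deriv ?_
    linear_combination (-(psiSum 0 1 b t₀ C D t * psiSum 1 2 b t₀ C D t)) * hε

end Dominated

lemma exists_gauge_le (C : ℂ) (M : ℝ) : ∃ R > 0, ∀ x, 0 < x → x < R → gauge C M x ≤ 1 / 2 := by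
  have h := (tendsto_gauge C M).eventually_le_const (show (0 : ℝ) < 1 / 2 by norm_num)
  obtain ⟨R, hR, hsub⟩ := mem_nhdsGT_iff_exists_Ioo_subset.mp h
  exact ⟨R, hR, fun x h0 hx => hsub ⟨h0, hx⟩⟩

/-! ### Blow-up at the singular point -/

lemma self_mem_branchCut (b t₀ : ℂ) : t₀ ∈ branchCut b t₀ := ⟨0, le_rfl, by simp⟩

lemma tendsto_norm_sub_nhdsWithin (b t₀ : ℂ) :
    Filter.Tendsto (fun t => ‖t - t₀‖) (nhdsWithin t₀ (branchCut b t₀)ᶜ)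
      (nhdsWithin 0 (Set.Ioi 0)) := by
  refine tendsto_nhdsWithin_iff.mpr ⟨?_, ?_⟩
  · have : Filter.Tendsto (fun t => ‖t - t₀‖) (nhds t₀) (nhds ‖t₀ - t₀‖) :=
      Continuous.tendsto (by fun_prop) t₀
    rw [sub_self, norm_zero] at this
    exact this.mono_left nhdsWithin_le_nhds
  · filter_upwards [self_mem_nhdsWithin] with t ht
    refine norm_pos_iff.mpr (sub_ne_zero.mpr ?_)
    rintro rfl
    exact ht (self_mem_branchCut b t)

lemma tendsto_norm_psiSum_atTop {i : Fin 3} {k : ℕ} (hk : k ≠ 0) {b t₀ : ℂ} (C D : ℂ)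
    (hb : ‖b‖ = 1) {c : ℂ} (hc : c ≠ 0) (h0 : coeff D 0 i = Polynomial.C c) :
    Filter.Tendsto (fun t => ‖psiSum i k b t₀ C D t‖) (nhdsWithin t₀ (branchCut b t₀)ᶜ)
      Filter.atTop := by
  obtain ⟨K, M, hK, hM, hd⟩ := exists_dominates C D
  have hc' : 0 < ‖c‖ := norm_pos_iff.mpr hc
  have hlim := tendsto_norm_sub_nhdsWithin b t₀
  have hg := (tendsto_gauge C M).comp hlim
  have h1 := hg.eventually_le_const (show (0 : ℝ) < 1 / 2 by norm_num)
  -- This makes the tail, at most `2 * K * gauge / ‖t - t₀‖ ^ k`, no more than half of the leading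
  -- term.
  have h2 := hg.eventually_le_const (show 0 < ‖c‖ / (4 * K) by positivity)
  have hinv : Filter.Tendsto (fun t => ‖c‖ / 2 * (‖t - t₀‖⁻¹) ^ k)
      (nhdsWithin t₀ (branchCut b t₀)ᶜ) Filter.atTop :=
    (((Filter.tendsto_pow_atTop hk).comp
      (tendsto_inv_nhdsGT_zero.comp hlim)).const_mul_atTop (by positivity))
  refine Filter.tendsto_atTop_mono' _ ?_ hinv
  filter_upwards [h1, h2, self_mem_nhdsWithin] with t h1 h2 ht
  have hslit := mem_slitPlane_of_notMem_branchCut hb ht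
  have hu : 0 < ‖t - t₀‖ := norm_pos_iff.mpr (sub_ne_zero_of_mem_slitPlane hslit)
  have hrem := hd.norm_psiSum_sub_le (i := i) (k := k) hK hM hb hslit h1 1
  have hlead : ‖psiTerm i k b t₀ C D t 0‖ = ‖c‖ / ‖t - t₀‖ ^ k := by
    rw [psiTerm, h0, eval_C, norm_mul, norm_zpow, Nat.cast_zero, zero_sub, zpow_neg, zpow_natCast]
    rfl
  rw [Finset.sum_range_one, pow_one] at hrem
  have htri := norm_sub_norm_le (psiTerm i k b t₀ C D t 0) (psiSum i k b t₀ C D t)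
  rw [norm_sub_rev, hlead] at htri
  simp only [Function.comp_apply] at h2
  rw [le_div_iff₀ (by positivity)] at h2
  have h3 : 2 * K * gauge C M ‖t - t₀‖ / ‖t - t₀‖ ^ k ≤ ‖c‖ / 2 / ‖t - t₀‖ ^ k := by
    gcongr
    linarith
  have h4 : ‖c‖ / ‖t - t₀‖ ^ k - ‖c‖ / 2 / ‖t - t₀‖ ^ k = ‖c‖ / 2 * (‖t - t₀‖⁻¹) ^ k := by
    rw [inv_pow]; ring
  linarith

/-! ### Independence of the two parameters -/

lemma notMem_branchCut_of_pos {b t₀ : ℂ} (hb : ‖b‖ = 1) {x : ℝ} (hx : 0 < x) :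
    t₀ + (starRingEnd ℂ) b * (x : ℂ) ∉ branchCut b t₀ := by
  rintro ⟨p, hp, h⟩
  have hb0 : (starRingEnd ℂ) b ≠ 0 := by
    rw [Ne, map_eq_zero, ← norm_eq_zero, hb]
    exact one_ne_zero
  have h' : (starRingEnd ℂ) b * ((x + p : ℝ) : ℂ) = 0 := by
    push_cast
    linear_combination h
  have : x + p = 0 := by exact_mod_cast (mul_eq_zero.mp h').resolve_left hb0
  linarith

lemma mul_gauge_pow_eq (C : ℂ) (M : ℝ) {x : ℝ} (hx : 0 < x) (A : ℝ) (N : ℕ) :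
    A * gauge C M x ^ (N + 1) / x ^ N =
      A * M ^ (N + 1) * ((logBound C + |Real.log x|) ^ (N + 1) * x) := by
  rw [gauge, mul_pow, mul_pow, pow_succ x]
  field_simp

/-- If the series for `x` belonging to `(C, D)` and `(C', D')` agree near `t₀`, and their terms
agree up to the `N`-th, whose coefficients differ by a constant, then this constant is zero. -/
lemma eq_zero_of_psiSum_eq {b t₀ C D C' D' c : ℂ} (hb : ‖b‖ = 1) {ρ : ℝ} (hρ : 0 < ρ)
    (heq : ∀ t, ‖t - t₀‖ < ρ → t ∉ branchCut b t₀ →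
      psiSum 0 1 b t₀ C D t = psiSum 0 1 b t₀ C' D' t) (N : ℕ)
    (hlt : ∀ n < N, ∀ η : ℂ, (coeff D n 0).eval (η + C) = (coeff D' n 0).eval (η + C'))
    (hN : ∀ η : ℂ, (coeff D N 0).eval (η + C) - (coeff D' N 0).eval (η + C') = c) : c = 0 := by
  obtain ⟨K, M, hK, hM, hd⟩ := exists_dominates C D
  obtain ⟨K', M', hK', hM', hd'⟩ := exists_dominates C' D'
  have hlim : ∀ (C : ℂ) (A : ℝ), Filter.Tendsto
      (fun x : ℝ => A * ((logBound C + |Real.log x|) ^ (N + 1) * x))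
      (nhdsWithin 0 (Set.Ioi 0)) (nhds 0) := fun C A => by
    have := (tendsto_add_abs_log_pow_mul (logBound C) N.succ_ne_zero).const_mul A
    rwa [mul_zero] at this
  have hsum := (hlim C (2 * K * M ^ (N + 1))).add (hlim C' (2 * K' * M' ^ (N + 1)))
  rw [add_zero] at hsum
  rw [← norm_le_zero_iff]
  refine ge_of_tendsto hsum ?_
  filter_upwards [(tendsto_gauge C M).eventually_le_const (show (0 : ℝ) < 1 / 2 by norm_num),
    (tendsto_gauge C' M').eventually_le_const (show (0 : ℝ) < 1 / 2 by norm_num),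
    Ioo_mem_nhdsGT hρ] with x hg hg' hx
  -- Test points on the ray opposite to the cut, where `b * (t - t₀) = x > 0`.
  obtain ⟨t, ht⟩ : ∃ t, t = t₀ + (starRingEnd ℂ) b * (x : ℂ) := ⟨_, rfl⟩
  have hcut : t ∉ branchCut b t₀ := ht ▸ notMem_branchCut_of_pos hb hx.1
  have hnorm : ‖t - t₀‖ = x := by
    rw [ht, add_sub_cancel_left, norm_mul, RCLike.norm_conj, hb, one_mul, Complex.norm_real,
      Real.norm_of_nonneg hx.1.le]
  have hslit := mem_slitPlane_of_notMem_branchCut hb hcut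
  have h1 := hd.norm_psiSum_sub_le (i := 0) (k := 1) hK hM hb hslit (by rwa [hnorm]) (N + 1)
  have h2 := hd'.norm_psiSum_sub_le (i := 0) (k := 1) hK' hM' hb hslit (by rwa [hnorm]) (N + 1)
  rw [heq t (by rw [hnorm]; exact hx.2) hcut] at h1
  have hdiff : (∑ n ∈ Finset.range (N + 1), psiTerm 0 1 b t₀ C D t n) -
      ∑ n ∈ Finset.range (N + 1), psiTerm 0 1 b t₀ C' D' t n = c * (t - t₀) ^ ((N : ℤ) - 1) := by
    rw [Finset.sum_range_succ, Finset.sum_range_succ, Finset.sum_congr rfl (g := fun n =>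
      psiTerm 0 1 b t₀ C' D' t n) fun n hn => by
        rw [psiTerm, psiTerm, etaC, etaC, hlt n (Finset.mem_range.mp hn)],
      add_sub_add_left_eq_sub, psiTerm, psiTerm, etaC, etaC, ← sub_mul, hN]
    norm_num
  have h3 : ‖c * (t - t₀) ^ ((N : ℤ) - 1)‖ ≤
      2 * K * gauge C M x ^ (N + 1) / x ^ 1 + 2 * K' * gauge C' M' x ^ (N + 1) / x ^ 1 := by
    rw [hnorm] at h1 h2
    rw [← hdiff]
    refine le_trans (le_of_eq ?_) ((norm_sub_le _ _).trans ((add_comm _ _).trans_le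
      (add_le_add h1 h2)))
    congr 1
    ring
  rw [norm_mul, norm_zpow, hnorm, zpow_sub_one₀ hx.1.ne', zpow_natCast] at h3
  rw [← mul_gauge_pow_eq C M hx.1, ← mul_gauge_pow_eq C' M' hx.1]
  -- Dividing by `x ^ (N - 1)` isolates `‖c‖`; the tails keep one factor `x`, which beats the powers
  -- of the logarithm.
  have h4 := mul_le_mul_of_nonneg_right h3 (show 0 ≤ x / x ^ N from
    div_nonneg hx.1.le (pow_nonneg hx.1.le N))
  have hx0 := hx.1.ne'
  calc ‖c‖ = ‖c‖ * (x ^ N * x⁻¹) * (x / x ^ N) := by field_simp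
    _ ≤ _ := h4
    _ = _ := by field_simp

end LorenzPsi

end

theorem theorem4p6 :
    -- the psi series converge and solve the Lorenz system on the slit disc;
    -- the solutions are singular at `t₀`
    (∀ C D : ℂ, ∃ r : ℝ, 0 < r ∧ ∀ ε b t₀ : ℂ, (ε = 1 ∨ ε = -1) → ‖b‖ = 1 →
      (∀ t : ℂ, ‖t - t₀‖ ≤ r → t ∉ LorenzPsi.branchCut b t₀ →
        Summable (fun n => ‖LorenzPsi.xTerm ε b t₀ C D t n‖) ∧
        Summable (fun n => ‖LorenzPsi.yTerm ε b t₀ C D t n‖) ∧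
        Summable (fun n => ‖LorenzPsi.zTerm b t₀ C D t n‖) ∧
        LorenzPsi.SatisfiesLorenzAt (LorenzPsi.psiX ε b t₀ C D) (LorenzPsi.psiY ε b t₀ C D)
          (LorenzPsi.psiZ b t₀ C D) t) ∧
      Filter.Tendsto (fun t => ‖LorenzPsi.psiX ε b t₀ C D t‖)
        (nhdsWithin t₀ (LorenzPsi.branchCut b t₀)ᶜ) Filter.atTop ∧
      Filter.Tendsto (fun t => ‖LorenzPsi.psiY ε b t₀ C D t‖)
        (nhdsWithin t₀ (LorenzPsi.branchCut b t₀)ᶜ) Filter.atTop ∧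
      Filter.Tendsto (fun t => ‖LorenzPsi.psiZ b t₀ C D t‖)
        (nhdsWithin t₀ (LorenzPsi.branchCut b t₀)ᶜ) Filter.atTop) ∧
    -- the family has two genuine parameters: different `(C, D)` give different solutions,
    -- however close to `t₀`
    (∀ ε b t₀ C D C' D' : ℂ, (ε = 1 ∨ ε = -1) → ‖b‖ = 1 → (C, D) ≠ (C', D') →
      ∀ ρ : ℝ, 0 < ρ → ∃ t : ℂ, ‖t - t₀‖ < ρ ∧ t ∉ LorenzPsi.branchCut b t₀ ∧
        (LorenzPsi.psiX ε b t₀ C D t, LorenzPsi.psiY ε b t₀ C D t, LorenzPsi.psiZ b t₀ C D t) ≠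
        (LorenzPsi.psiX ε b t₀ C' D' t, LorenzPsi.psiY ε b t₀ C' D' t,
          LorenzPsi.psiZ b t₀ C' D' t)) := by
  refine ⟨fun C D => ?_, fun ε b t₀ C D C' D' hε hb hne ρ hρ => ?_⟩
  · obtain ⟨K, M, hK, hM, hd⟩ := LorenzPsi.exists_dominates C D
    obtain ⟨R, hR0, hR⟩ := LorenzPsi.exists_gauge_le C M
    -- The estimates hold for `‖t - t₀‖ < R`, whereas the disc in the claim is closed.
    refine ⟨R / 2, by positivity, fun ε b t₀ hε hb => ?_⟩
    have hεε : ε * ε = 1 := by rcases hε with rfl | rfl <;> norm_num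
    have hεn : ‖ε‖ = 1 := by rcases hε with rfl | rfl <;> simp
    refine ⟨fun t htr hcut => ?_, ?_, ?_, ?_⟩
    · have hslit := LorenzPsi.mem_slitPlane_of_notMem_branchCut hb hcut
      have htR : ‖t - t₀‖ < R := by linarith
      have hg := hR _ (norm_pos_iff.mpr (LorenzPsi.sub_ne_zero_of_mem_slitPlane hslit)) htR
      simp_rw [LorenzPsi.xTerm_eq, LorenzPsi.yTerm_eq, LorenzPsi.zTerm_eq, norm_mul, hεn, one_mul]
      exact ⟨hd.summable hK hM hb hslit hg, hd.summable hK hM hb hslit hg,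
        hd.summable hK hM hb hslit hg, hd.satisfiesLorenzAt hK hM hR hεε hb hslit htR⟩
    · simp_rw [LorenzPsi.psiX_eq, norm_mul, hεn, one_mul]
      exact LorenzPsi.tendsto_norm_psiSum_atTop one_ne_zero C D hb (c := 2 * Complex.I)
        (by simp) (by simp [LorenzPsi.coeff, LorenzPsi.quad])
    · simp_rw [LorenzPsi.psiY_eq, norm_mul, hεn, one_mul]
      exact LorenzPsi.tendsto_norm_psiSum_atTop two_ne_zero C D hb (c := -Complex.I / 5)
        (by simp) (by simp [LorenzPsi.coeff, LorenzPsi.quad])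
    · simp_rw [LorenzPsi.psiZ_eq]
      exact LorenzPsi.tendsto_norm_psiSum_atTop two_ne_zero C D hb (c := -1 / 5)
        (by simp) (by simp [LorenzPsi.coeff, LorenzPsi.quad])
  · by_contra! hcon
    have hε0 : ε ≠ 0 := by rcases hε with rfl | rfl <;> simp
    have heq : ∀ t, ‖t - t₀‖ < ρ → t ∉ LorenzPsi.branchCut b t₀ →
        LorenzPsi.psiSum 0 1 b t₀ C D t = LorenzPsi.psiSum 0 1 b t₀ C' D' t := fun t ht hcut => by
      have h := congrArg Prod.fst (hcon t ht hcut)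
      simp only [LorenzPsi.psiX_eq] at h
      exact mul_left_cancel₀ hε0 h
    have hC : C = C' := by
      -- `P₁` (index 2) is the first coefficient of `x` that depends on `s`; it is linear, so equal
      -- `η` leaves its slope times `C - C'`.
      have h := LorenzPsi.eq_zero_of_psiSum_eq (c := -9880 / 81 * Complex.I * (C - C')) hb hρ heq 2
        (fun n hn η => by interval_cases n <;> simp [LorenzPsi.coeff, LorenzPsi.quad])
        (fun η => by simp [LorenzPsi.coeff, LorenzPsi.quad]; ring)
      exact sub_eq_zero.mp (by simpa using h)
    subst hC
    have hD : D = D' := by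
      -- With `C` fixed, `D` first appears in `P₃` (index 4), as the constant term `i D`.
      have h := LorenzPsi.eq_zero_of_psiSum_eq (c := Complex.I * (D - D')) hb hρ heq 4
        (fun n hn η => by interval_cases n <;> simp [LorenzPsi.coeff, LorenzPsi.quad])
        (fun η => by simp [LorenzPsi.coeff, LorenzPsi.quad]; ring)
      exact sub_eq_zero.mp (by simpa using h)
    exact hne (by rw [hD])
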